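/- **Setting.** A fair division instance consists of agents $[n]$, items $[m]$ and additive valuations $v_a(S)=\sum_{x\in S}v_a(x)$ with $v_a(x)\in[0,1]$ for all $a\in[n]$, $x\in[m]$. Put $\mathsf{PROP}_a=v_a([m])/n$. Agents arrive one after the other in an order $\tau=(\tau_1,\dots,\tau_n)$. On each arrival the items not yet taken are presented, divided into as many parts as there are agents still present; the arriving agent picks autonomously and rationally, i.e. takes a part of maximum value to her among those presented (ties broken arbitrarily), and leaves with it. The parts are formed by the following recursive rebundling algorithm. *Algorithm.* Let $U$ be the set of remaining items and let the remaining agents be renumbered $1,\dots,N$ in order of arrival. If $N=1$, present $U$. Otherwise let $M=(M[1],\dots,M[N])$ be the Round-Robin partition of $U$ with picking order $1,\dots,N$ (each pick is a most preferred available item, ties broken by least index), let $M[r,c]$ be the $r$-th pick of agent $c$, and let $\mathrm{mid}=\lfloor N/2\rfloor$. Call the items $M[r,c]$ with $r\in\{1,2\}$, $c>\mathrm{mid}$ that have not been moved the donor items. For $i=1,\dots,\mathrm{mid}$, when agent $i$ arrives: - if $i=\mathrm{mid}$, move all donor items to $M[i]$ and present the unpicked parts of $M$; - if $i<\mathrm{mid}$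 and agent $i$ values some donor item positively, move the first such item (in index order) to $M[i]$ and present the unpicked parts of $M$; - otherwise present the unpicked parts of the temporary partition $M'$ obtained from $M$ by exchanging the top items $M[1,i+k]$ and $M[1,\mathrm{mid}+k]$ for $k=1,\dots,\mathrm{mid}-i$ (a top item that was moved earlier counts as absent), and return to $M$ after the pick. Then recurse on the items of the unpicked parts and the agents $\mathrm{mid}+1,\dots,N$. (If an agent $i$ takes a part other than the $i$-th one, a temporary partition that she was shown is kept, and from then on the stage omits moves from or into parts that are already taken.) Let $g=g_n:[n]\to\mathbb N$ give the stage of the recursion in which the agent in position $i$ picks: $g_1(1)=1$ and, for $n\ge2$, $g_n(i)=1$ if $i\le\lfloor n/2\rfloor$, and $g_n(i)=1+g_{n-\lfloor n/2\rfloor}(i-\lfloor n/2\rfloor)$ if $i>\lfloor n/2\rfloor$. **Statement.** For every fair division instance there is an arrival order $\tau$ such that, when the agents arrive in the order $\tau$ and pick autonomously and rationally from the parts presented by the algorithm, for each $i\in[n]$ the agent $\tau_i$ gets a part of value at least $$\mathsf{PROP}_{\tau_i}-2g(i)-2 .$$ Moreover, $\tau$ can be computed in polynomial time: there are one program and one polynomial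 $T$ such that, for every instance with $n$ agents and $m$ items, the program computes such a $\tau$ from the matrix $(v_a(x))_{a,x}$ in at most $T(n+m)$ steps on a random access machine whose steps are additions, subtractions and comparisons of numbers (real or natural), constants, and indirect memory accesses. -/

import Mathlib

open scoped BigOperators

noncomputable section

/-- A fair division instance with `n` agents and `m` items: additive non-negative valuations,
normalised so that every single item is worth at most `1` to every agent. -/
structure FairInstance (n m : ℕ) where
  val : Fin n → Fin m → ℝ
  val_nonneg : ∀ a g, 0 ≤ val a g
  val_le_one : ∀ a g, val a g ≤ 1

/-- The recursive stage in which the agent arriving at position `i` (counted from `1`) among `n`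
agents picks. With a single agent left there is only one stage. -/
def stageOf (n i : ℕ) : ℕ :=
  if n ≤ 1 then 1
  else if i ≤ n / 2 then 1
  else 1 + stageOf (n - n / 2) (i - n / 2)
termination_by n
decreasing_by omega

/-- How the agents choose: given the agent, the labels of the parts still on offer, and the content
of the part with each label, the label of the part that the agent takes. -/
abbrev ChoiceRule (n m : ℕ) : Type :=
  Fin n → Finset ℕ → (ℕ → Finset (Fin m)) → ℕ

namespace FairInstance

variable {n m : ℕ} (I : FairInstance n m)

/-- Additive value of a set of items. -/
def value (a : Fin n) (S : Finset (Fin m)) : ℝ := ∑ g ∈ S, I.val a g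

/-- Proportional share. -/
def prop (a : Fin n) : ℝ := I.value a Finset.univ / n

/-- Every agent takes a part of maximum value among those on offer. Ties are broken arbitrarily. -/
def Rational (choose : ChoiceRule n m) : Prop :=
  ∀ (a : Fin n) (A : Finset ℕ) (P : ℕ → Finset (Fin m)), A.Nonempty →
    choose a A P ∈ A ∧ ∀ q ∈ A, I.value a (P q) ≤ I.value a (P (choose a A P))

/-! ### Round-Robin -/

/-- A most preferred item of agent `a` in `U` (the one of least index, if there are several). -/
def topItem (a : Fin n) (U : Finset (Fin m)) : Option (Fin m) :=
  (List.finRange m).find? fun g => decide (g ∈ U ∧ ∀ h ∈ U, I.val a h ≤ I.val a g)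

/-- The items picked in the first `k` turns of Round-Robin from `U`, in order of picking. The agent
at the head of the list picks and then moves to the back. -/
def roundRobinAux : ℕ → List (Fin n) → Finset (Fin m) → List (Fin m)
  | 0, _, _ => []
  | _ + 1, [], _ => []
  | k + 1, a :: L, U =>
    match I.topItem a U with
    | none => []
    | some g => g :: roundRobinAux k (L ++ [a]) (U.erase g)

/-- Round-Robin on the items `U` with picking sequence `L`, as the list of picks. -/
def roundRobin (L : List (Fin n)) (U : Finset (Fin m)) : List (Fin m) :=
  I.roundRobinAux U.card L U

end FairInstance

/-! ### One stage of the rebundling algorithm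

Within a stage with `N` agents, parts carry the labels `0, …, N - 1`. A partition of the item set `U`
of the stage is a map `own` from items to labels, so that part `q` is `{g ∈ U | own g = q}`. The set
`A` holds the labels of the unpicked parts. The pick with index `t` in the list `picks` of Round-Robin
is the entry of the Round-Robin matrix in row `t / N` and column `t % N`. -/

/-- Row of an item in the Round-Robin matrix, counted from `0`. -/
def rrRow {m : ℕ} (N : ℕ) (picks : List (Fin m)) (g : Fin m) : ℕ := picks.idxOf g / N

/-- Column of an item in the Round-Robin matrix, counted from `0`. -/
def rrCol {m : ℕ} (N : ℕ) (picks : List (Fin m)) (g : Fin m) : ℕ := picks.idxOf g % N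

/-- Part `q` of a partition of `U`. -/
def partOf {m : ℕ} (U : Finset (Fin m)) (own : Fin m → ℕ) (q : ℕ) : Finset (Fin m) :=
  U.filter fun g => own g = q

/-- The item sits at its original place in the Round-Robin matrix, in an unpicked part. -/
def InPlace {m : ℕ} (N : ℕ) (picks : List (Fin m)) (U : Finset (Fin m)) (own : Fin m → ℕ)
    (A : Finset ℕ) (g : Fin m) : Prop :=
  g ∈ U ∧ own g = rrCol N picks g ∧ own g ∈ A

instance {m : ℕ} (N : ℕ) (picks : List (Fin m)) (U : Finset (Fin m)) (own : Fin m → ℕ)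
    (A : Finset ℕ) (g : Fin m) : Decidable (InPlace N picks U own A g) := by
  unfold InPlace; infer_instance

/-- A donor item: an item still in place in the top two rows of the columns `mid, …, N - 1`
of the agents who do not pick in this stage. -/
def IsDonor {m : ℕ} (N : ℕ) (picks : List (Fin m)) (U : Finset (Fin m)) (own : Fin m → ℕ)
    (A : Finset ℕ) (g : Fin m) : Prop :=
  InPlace N picks U own A g ∧ rrRow N picks g < 2 ∧ N / 2 ≤ rrCol N picks g

instance {m : ℕ} (N : ℕ) (picks : List (Fin m)) (U : Finset (Fin m)) (own : Fin m → ℕ)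
    (A : Finset ℕ) (g : Fin m) : Decidable (IsDonor N picks U own A g) := by
  unfold IsDonor; infer_instance

/-- The exchange of the labels `i + k` and `mid + k - 1` for `1 ≤ k ≤ mid - 1 - i` (labels counted
from `0`); all other labels are fixed. -/
def swapLabel (mid i c : ℕ) : ℕ :=
  if i < c ∧ c < mid then mid + (c - i) - 1
  else if mid ≤ c ∧ c + i + 1 < 2 * mid then i + (c - mid) + 1
  else c

/-- Temporary rebundling for agent `i`: the top items of the parts `i + k` and `mid + k - 1` are
exchanged for `1 ≤ k ≤ mid - 1 - i`. A missing top item is replaced by nothing; a pair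
of parts one of which has been picked is left alone. -/
def rebundle {m : ℕ} (N i : ℕ) (picks : List (Fin m)) (U : Finset (Fin m)) (own : Fin m → ℕ)
    (A : Finset ℕ) : Fin m → ℕ := fun g =>
  if InPlace N picks U own A g ∧ rrRow N picks g = 0 ∧ swapLabel (N / 2) i (own g) ∈ A
  then swapLabel (N / 2) i (own g) else own g

namespace FairInstance

variable {n m : ℕ} (I : FairInstance n m)

/-- What the algorithm does when agent `a` arrives as number `i` (counted from `0`) of a stage with
`N` agents: the first component is the partition with the permanent changes made, the second is the
partition that is presented. If the part with label `i` is gone (an earlier agent took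
it), nothing is changed. -/
def prepare (N : ℕ) (picks : List (Fin m)) (U : Finset (Fin m)) (i : ℕ) (a : Fin n)
    (own : Fin m → ℕ) (A : Finset ℕ) : (Fin m → ℕ) × (Fin m → ℕ) :=
  if i ∉ A then (own, own)
  else if i + 1 = N / 2 then
    let M : Fin m → ℕ := fun g => if IsDonor N picks U own A g then i else own g
    (M, M)
  else
    match (List.finRange m).find? fun g => decide (IsDonor N picks U own A g ∧ 0 < I.val a g) with
    | some g => (Function.update own g i, Function.update own g i)
    | none => (own, rebundle N i picks U own A)

/-- The picking phase of a stage: the listed agents arrive one after the other, the first of them as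
number `i`. Returns the bundles taken, in order of arrival, and the items left over. The temporary
partition is discarded once agent `i` has taken part `i`; it is kept if the agent took
another part, whose content it may have changed. -/
def pickingPhase (choose : ChoiceRule n m) (N : ℕ) (picks : List (Fin m)) (U : Finset (Fin m)) :
    List (Fin n) → ℕ → (Fin m → ℕ) → Finset ℕ → List (Finset (Fin m)) × Finset (Fin m)
  | [], _, own, A => ([], U.filter fun g => own g ∈ A)
  | a :: rest, i, own, A =>
    let MM := I.prepare N picks U i a own A
    let q := choose a A (partOf U MM.2)
    let r := pickingPhase choose N picks U rest (i + 1) (if q = i then MM.1 else MM.2) (A.erase q)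
    (partOf U MM.2 q :: r.1, r.2)

/-- The algorithm for bounded proportional shares: `L` lists the agents in order of arrival, `U` is
the set of available items. Returns the bundles taken by the agents, in order of arrival. -/
def boundedProp (choose : ChoiceRule n m) (L : List (Fin n)) (U : Finset (Fin m)) :
    List (Finset (Fin m)) :=
  if L.length ≤ 1 then L.map fun _ => U
  else
    let N := L.length
    let picks := I.roundRobin L U
    let r := I.pickingPhase choose N picks U (L.take (N / 2)) 0 (rrCol N picks) (Finset.range N)
    r.1 ++ boundedProp choose (L.drop (N / 2)) r.2
termination_by L.length
decreasing_by simp only [List.length_drop]; omega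

/-- The bundle obtained by the agent `τ i` when the agents arrive in the order `τ` and choose by the
rule `choose` from the parts presented by the algorithm. -/
def received (choose : ChoiceRule n m) (τ : Equiv.Perm (Fin n)) (i : Fin n) : Finset (Fin m) :=
  (I.boundedProp choose (List.ofFn τ) Finset.univ).getD i ∅

end FairInstance

/-! ### A random access machine with unit costs

The machine has natural-number registers and real registers, and a memory of each kind that is addressed
indirectly through natural-number registers. The only arithmetic is addition and subtraction (no
multiplication, no rounding, no real constants besides `0` and `1`), so a computation of `t` steps
enlarges the numbers by at most `t` bits. -/

structure Mem where
  nreg : ℕ → ℕ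
  rreg : ℕ → ℝ
  nmem : ℕ → ℕ
  rmem : ℕ → ℝ

inductive Instr where
  | nconst (x k : ℕ)
  | nadd (x y z : ℕ)
  | nsub (x y z : ℕ)
  | nload (x y : ℕ)
  | nstore (x y : ℕ)
  | rzero (x : ℕ)
  | rone (x : ℕ)
  | radd (x y z : ℕ)
  | rsub (x y z : ℕ)
  | rload (x y : ℕ)
  | rstore (x y : ℕ)

def Instr.apply (s : Mem) : Instr → Mem
  | .nconst x k => { s with nreg := Function.update s.nreg x k }
  | .nadd x y z => { s with nreg := Function.update s.nreg x (s.nreg y + s.nreg z) }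
  | .nsub x y z => { s with nreg := Function.update s.nreg x (s.nreg y - s.nreg z) }
  | .nload x y => { s with nreg := Function.update s.nreg x (s.nmem (s.nreg y)) }
  | .nstore x y => { s with nmem := Function.update s.nmem (s.nreg x) (s.nreg y) }
  | .rzero x => { s with rreg := Function.update s.rreg x 0 }
  | .rone x => { s with rreg := Function.update s.rreg x 1 }
  | .radd x y z => { s with rreg := Function.update s.rreg x (s.rreg y + s.rreg z) }
  | .rsub x y z => { s with rreg := Function.update s.rreg x (s.rreg y - s.rreg z) }
  | .rload x y => { s with rreg := Function.update s.rreg x (s.rmem (s.nreg y)) }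
  | .rstore x y => { s with rmem := Function.update s.rmem (s.nreg x) (s.rreg y) }

/-- Comparison of two registers. -/
inductive RegTest where
  | nle (x y : ℕ)
  | rle (x y : ℕ)

def RegTest.Holds (s : Mem) : RegTest → Prop
  | .nle x y => s.nreg x ≤ s.nreg y
  | .rle x y => s.rreg x ≤ s.rreg y

inductive Program where
  | instr (c : Instr)
  | seq (p q : Program)
  | cond (b : RegTest) (p q : Program)
  | loop (b : RegTest) (p : Program)

/-- `Exec p s s' t`: started in memory `s`, the program `p` halts in memory `s'` after exactly `t`
steps. An instruction is one step, and so is each evaluation of a test; `loop b p` repeats `p` as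
long as `b` holds. -/
inductive Exec : Program → Mem → Mem → ℕ → Prop
  | instr (c : Instr) (s : Mem) : Exec (.instr c) s (c.apply s) 1
  | seq {p q : Program} {s s' s'' : Mem} {t t' : ℕ} :
      Exec p s s' t → Exec q s' s'' t' → Exec (.seq p q) s s'' (t + t')
  | cond_true {b : RegTest} {p q : Program} {s s' : Mem} {t : ℕ} :
      b.Holds s → Exec p s s' t → Exec (.cond b p q) s s' (t + 1)
  | cond_false {b : RegTest} {p q : Program} {s s' : Mem} {t : ℕ} :
      ¬ b.Holds s → Exec q s s' t → Exec (.cond b p q) s s' (t + 1)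
  | loop_true {b : RegTest} {p : Program} {s s' s'' : Mem} {t t' : ℕ} :
      b.Holds s → Exec p s s' t → Exec (.loop b p) s' s'' t' →
      Exec (.loop b p) s s'' (t + t' + 1)
  | loop_false {b : RegTest} {p : Program} {s : Mem} :
      ¬ b.Holds s → Exec (.loop b p) s s 1

/-- The input: `n` and `m` in the first two natural-number registers, the valuation matrix row by row
(the value of agent `a` for item `g` at address `a * m + g`) in the real memory, and `0` elsewhere. -/
def FairInstance.input {n m : ℕ} (I : FairInstance n m) : Mem where
  nreg := fun x => if x = 0 then n else if x = 1 then m else 0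
  rreg := fun _ => 0
  nmem := fun _ => 0
  rmem := fun k => if h : k < n * m then I.val (Fin.divNat ⟨k, h⟩) (Fin.modNat ⟨k, h⟩) else 0

/-- On the instance `I` the program halts within `T` steps, with the order `τ` written in the first `n`
cells of the natural-number memory. -/
def Program.ComputesOrder {n m : ℕ} (p : Program) (I : FairInstance n m) (τ : Equiv.Perm (Fin n))
    (T : ℕ) : Prop :=
  ∃ (s : Mem) (t : ℕ), Exec p I.input s t ∧ t ≤ T ∧ ∀ i : Fin n, s.nmem i = (τ i : ℕ)

end

/-! ### Round-Robin -/

namespace FairInstance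

variable {n m : ℕ} (I : FairInstance n m)

/-! The agents arrive in order of decreasing total value, that is, of decreasing proportional share.

Fix a stage with `N` agents, and suppose each agent of its first half values her own Round-Robin
column at more than `1`. Then each strictly prefers the part with her number, whatever the
tie-breaking. The reason is that an item picked at or after her turn in a row is worth at most her
own item of that row (`dominates_roundRobin`). Hence a set with at most one item of positive value
per row, all in columns not before hers, is worth at most her column, and strictly less if row `0`
or row `1` is missing (`Dominates.value_le`, `Dominates.exists_pos`). The rebundling makes every
other part miss one of these rows, or else gives her own part an extra item of positive value
(`prepare_spec`).

After such a stage exactly the rows from `2` on of the remaining columns are left. Round-Robin is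
consistent under the departure of agents with their picks, so the next stage rebuilds these
truncated columns (`partOf_roundRobin_drop`). A stage therefore costs a remaining agent at most `2`,
while her remaining stage number falls by `1`, and "column worth more than `2 g - 1`" passes from
stage to stage (`boundedProp_spec`).

In the initial partition, a column is worth at least the proportional share minus `1` to its owner
(`value_le_length_mul`). An agent with share at most `2 g + 2` is promised nothing. For any other
agent, all her predecessors have at least her share and at most her stage number, so they too are
rich enough to take their own parts. Later agents do not matter.

The order requires only row sums and sorting. The program finds the rank of each sum by counting, in
quadratic time. -/

theorem topItem_spec {a : Fin n} {U : Finset (Fin m)} {g : Fin m} (h : I.topItem a U = some g) :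
    g ∈ U ∧ ∀ x ∈ U, I.val a x ≤ I.val a g := by
  have := List.find?_some h
  simpa using this

theorem exists_topItem (a : Fin n) {U : Finset (Fin m)} (hU : U.Nonempty) :
    ∃ g, I.topItem a U = some g := by
  obtain ⟨g, hg, hmax⟩ := U.exists_max_image (I.val a) hU
  rw [← Option.isSome_iff_exists, topItem, List.find?_isSome]
  exact ⟨g, List.mem_finRange g, by simpa using ⟨hg, hmax⟩⟩

/-- Choosing the least index among the maxima is consistent: shrinking the set without losing the
chosen item creates no earlier maximum. This makes Round-Robin compatible with departures, ties
included. -/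
theorem topItem_mono {a : Fin n} {U V : Finset (Fin m)} {g : Fin m} (hVU : V ⊆ U) (hg : g ∈ V)
    (h : I.topItem a U = some g) : I.topItem a V = some g := by
  have hs := I.topItem_spec h
  unfold topItem at h ⊢
  rw [List.find?_eq_some_iff_append] at h ⊢
  obtain ⟨-, l₁, l₂, hl, hlt⟩ := h
  refine ⟨by simpa using ⟨hg, fun x hx => hs.2 x (hVU hx)⟩, l₁, l₂, hl, fun x hx => ?_⟩
  have hx' := hlt x hx
  simp only [Bool.not_eq_true', decide_eq_false_iff_not] at hx' ⊢
  rintro ⟨hxV, hxm⟩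
  exact hx' ⟨hVU hxV, fun y hy => (hs.2 y hy).trans (hxm g hg)⟩

/-- The list of pairs (agent, item picked) is a complete run of Round-Robin with picking
sequence `L`, the set of items being that of the items listed. -/
def IsRoundRobin : List (Fin n) → List (Fin n × Fin m) → Prop
  | _, [] => True
  | L, x :: q => L.head? = some x.1 ∧ x.2 ∉ q.map Prod.snd ∧
      I.topItem x.1 ((x :: q).map Prod.snd).toFinset = some x.2 ∧ IsRoundRobin (L.rotate 1) q

/-- Recording who picks each item makes it possible to delete agents from a run, which the bare list
of picks does not allow. -/
theorem exists_isRoundRobin (k : ℕ) : ∀ (L : List (Fin n)) (U : Finset (Fin m)), L ≠ [] →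
    U.card = k → ∃ q, I.IsRoundRobin L q ∧ q.map Prod.snd = I.roundRobinAux k L U ∧
      (q.map Prod.snd).toFinset = U := by
  induction k with
  | zero =>
    intro L U _ hU
    exact ⟨[], trivial, by simp [roundRobinAux], by simpa using (Finset.card_eq_zero.1 hU).symm⟩
  | succ k ih =>
    intro L U hL hU
    obtain ⟨a, L, rfl⟩ := List.exists_cons_of_ne_nil hL
    obtain ⟨g, hg⟩ := I.exists_topItem a (U := U) (Finset.card_pos.1 (by omega))
    have hgU := (I.topItem_spec hg).1
    obtain ⟨q, hq, hmap, hset⟩ := ih (L ++ [a]) (U.erase g) (by simp)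
      (by rw [Finset.card_erase_of_mem hgU]; omega)
    have hset' : (((a, g) :: q).map Prod.snd).toFinset = U := by
      rw [List.map_cons, List.toFinset_cons, hset, Finset.insert_erase hgU]
    refine ⟨(a, g) :: q, ⟨by simp, ?_, by rw [hset']; exact hg, by simpa using hq⟩, ?_, hset'⟩
    · rw [← List.mem_toFinset, hset]; simp
    · simp [roundRobinAux, hg, hmap]

theorem IsRoundRobin.nodup {I : FairInstance n m} : ∀ {q : List (Fin n × Fin m)}
    {L : List (Fin n)}, I.IsRoundRobin L q → (q.map Prod.snd).Nodup
  | [], _, _ => by simp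
  | x :: q, L, h => by
    rw [List.map_cons, List.nodup_cons]
    exact ⟨h.2.1, h.2.2.2.nodup⟩

theorem IsRoundRobin.roundRobinAux_eq {I : FairInstance n m} : ∀ {q : List (Fin n × Fin m)}
    {L : List (Fin n)}, I.IsRoundRobin L q →
      I.roundRobinAux q.length L (q.map Prod.snd).toFinset = q.map Prod.snd
  | [], _, _ => by simp [roundRobinAux]
  | x :: q, [], h => by simp [IsRoundRobin] at h
  | x :: q, a :: L, h => by
    obtain ⟨hh, hn, ht, hr⟩ := h
    have hh' : a = x.1 := by simpa using hh
    have := hr.roundRobinAux_eq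
    subst hh'
    rw [List.length_cons, roundRobinAux, ht]
    simp only [List.map_cons, List.toFinset_cons]
    rw [Finset.erase_insert (by rwa [List.mem_toFinset])]
    simpa using this

theorem IsRoundRobin.roundRobin_eq {I : FairInstance n m} {q : List (Fin n × Fin m)}
    {L : List (Fin n)} (h : I.IsRoundRobin L q) :
    I.roundRobin L (q.map Prod.snd).toFinset = q.map Prod.snd := by
  rw [roundRobin, List.toFinset_card_of_nodup h.nodup, List.length_map, h.roundRobinAux_eq]

theorem IsRoundRobin.drop {I : FairInstance n m} : ∀ (t : ℕ) {q : List (Fin n × Fin m)}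
    {L : List (Fin n)}, I.IsRoundRobin L q → I.IsRoundRobin (L.rotate t) (q.drop t)
  | 0, _, _, h => by simpa using h
  | t + 1, [], _, _ => by simp [IsRoundRobin]
  | t + 1, x :: q, L, h => by
    have := IsRoundRobin.drop t h.2.2.2
    rwa [List.rotate_rotate, add_comm 1 t] at this

/-- Round-Robin is consistent: if some agents leave with what they picked, a new run of
Round-Robin gives every other agent the same items. -/
theorem IsRoundRobin.filter {I : FairInstance n m} (S : Fin n → Bool) :
    ∀ {q : List (Fin n × Fin m)} {L : List (Fin n)}, I.IsRoundRobin L q →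
      I.IsRoundRobin (L.filter S) (q.filter fun x => S x.1)
  | [], _, _ => by simp [IsRoundRobin]
  | x :: q, [], h => by simp [IsRoundRobin] at h
  | x :: q, a :: L, h => by
    obtain ⟨hh, hn, ht, hr⟩ := h
    have hh' : a = x.1 := by simpa using hh
    have ih := hr.filter S
    subst hh'
    simp only [List.rotate_cons_succ, List.rotate_zero, List.filter_append] at ih
    -- An agent who stays moves to the back of the filtered list as well. For one who leaves,
    -- filtering the rotated list gives the same result as filtering the original one.
    by_cases hS : S x.1 = true
    · rw [List.filter_cons_of_pos hS, List.filter_cons_of_pos (by exact hS)]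
      refine ⟨rfl, fun hx => hn ?_, I.topItem_mono ?_ (by simp) ht, by simpa [hS] using ih⟩
      · exact List.map_subset _ (List.filter_subset_self _) hx
      · intro y hy
        rw [List.mem_toFinset] at hy ⊢
        rw [List.map_cons, List.mem_cons] at hy ⊢
        exact hy.imp_right fun hy => List.map_subset _ (List.filter_subset_self _) hy
    · rw [List.filter_cons_of_neg hS, List.filter_cons_of_neg (by exact hS)]
      simpa [hS] using ih

/-! ### Rows and columns of a Round-Robin run -/

theorem IsRoundRobin.fst_getElem {I : FairInstance n m} {q : List (Fin n × Fin m)}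
    {L : List (Fin n)} (h : I.IsRoundRobin L q) {t : ℕ} (ht : t < q.length)
    (hN : t % L.length < L.length) : q[t].1 = L[t % L.length] := by
  have hd := h.drop t
  rw [List.drop_eq_getElem_cons ht] at hd
  have h1 := hd.1
  rw [← List.rotate_mod, List.head?_rotate hN, List.getElem?_eq_getElem hN] at h1
  exact (Option.some.inj h1).symm

theorem IsRoundRobin.val_le {I : FairInstance n m} {q : List (Fin n × Fin m)}
    {L : List (Fin n)} (h : I.IsRoundRobin L q) {t t' : ℕ} (htt : t ≤ t') (ht' : t' < q.length) :
    I.val q[t].1 q[t'].2 ≤ I.val q[t].1 q[t].2 := by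
  have hd := h.drop t
  rw [List.drop_eq_getElem_cons (by omega)] at hd
  refine (I.topItem_spec hd.2.2.1).2 _ ?_
  rw [← List.drop_eq_getElem_cons, List.mem_toFinset, List.mem_map]
  exact ⟨q[t'], List.mem_drop_iff_getElem.2 ⟨t' - t, by omega, by simp [Nat.add_sub_cancel' htt]⟩, rfl⟩

theorem IsRoundRobin.mem_drop_iff {I : FairInstance n m} {q : List (Fin n × Fin m)}
    {L : List (Fin n)} (h : I.IsRoundRobin L q) (hL : L.Nodup) {c : ℕ} (hc : c < L.length)
    (s : ℕ) (g : Fin m) :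
    (L[c], g) ∈ q.drop s ↔ g ∈ q.map Prod.snd ∧ rrCol L.length (q.map Prod.snd) g = c ∧
      s ≤ (q.map Prod.snd).idxOf g := by
  have hlt (t : ℕ) : t % L.length < L.length := Nat.mod_lt _ (by omega)
  constructor
  · intro hx
    obtain ⟨t, ht, hqt⟩ := List.mem_drop_iff_getElem.1 hx
    rw [add_comm] at ht
    have ht' : s + t < (q.map Prod.snd).length := by simpa using ht
    have hg : (q.map Prod.snd)[s + t] = g := by simp [hqt]
    have hidx : (q.map Prod.snd).idxOf g = s + t := by
      rw [← hg]; exact h.nodup.idxOf_getElem _ _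
    refine ⟨hg ▸ List.getElem_mem _, ?_, by omega⟩
    have hf := h.fst_getElem ht (hlt _)
    rw [hqt] at hf
    rw [rrCol, hidx]
    exact ((hL.getElem_inj_iff).1 hf).symm
  · rintro ⟨hg, hcol, hs⟩
    have ht := List.idxOf_lt_length_of_mem hg
    have ht' : (q.map Prod.snd).idxOf g < q.length := by simpa using ht
    refine List.mem_drop_iff_getElem.2 ⟨(q.map Prod.snd).idxOf g - s, by omega, ?_⟩
    simp only [Nat.add_sub_cancel' hs]
    refine Prod.ext ?_ ?_
    · rw [h.fst_getElem ht' (hlt _)]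
      congr 1
    · rw [← List.getElem_map Prod.snd (h := ht)]
      exact List.getElem_idxOf ht

/-- Every item picked in or after the turn of column `i` in row `r` is worth at most as much
to agent `a` as the item in that row and column. -/
def Dominates (a : Fin n) (N i : ℕ) (picks : List (Fin m)) (U : Finset (Fin m)) : Prop :=
  ∀ g ∈ U, ∀ r, r * N + i ≤ picks.idxOf g →
    ∃ h ∈ U, rrRow N picks h = r ∧ rrCol N picks h = i ∧ I.val a g ≤ I.val a h

variable {I}

theorem mem_roundRobin {L : List (Fin n)} (hL : L ≠ []) {U : Finset (Fin m)} {g : Fin m} :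
    g ∈ I.roundRobin L U ↔ g ∈ U := by
  obtain ⟨q, -, hmap, hset⟩ := I.exists_isRoundRobin _ L U hL rfl
  rw [roundRobin, ← hmap, ← List.mem_toFinset, hset]

/-- Pick number `r * N + i` is made by agent `L[i]` as her favourite among all items still
available, and these include every later pick. -/
theorem dominates_roundRobin {L : List (Fin n)} (U : Finset (Fin m)) {i : ℕ}
    (hi : i < L.length) : I.Dominates L[i] L.length i (I.roundRobin L U) U := by
  obtain ⟨q, hq, hmap, hset⟩ := I.exists_isRoundRobin _ L U (List.ne_nil_of_length_pos (by omega)) rfl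
  have hp : I.roundRobin L U = q.map Prod.snd := hmap.symm
  rw [hp]
  intro g hg r hr
  rw [← hset, List.mem_toFinset] at hg
  have ht := List.idxOf_lt_length_of_mem hg
  have ht' : (q.map Prod.snd).idxOf g < q.length := by simpa using ht
  have hmod : (r * L.length + i) % L.length = i := by
    rw [Nat.mul_add_mod_of_lt hi]
  have hdiv : (r * L.length + i) / L.length = r := by
    rw [mul_comm, Nat.mul_add_div (by omega), Nat.div_eq_of_lt hi, add_zero]
  have hs : r * L.length + i < (q.map Prod.snd).length := by omega
  have hidx := hq.nodup.idxOf_getElem _ hs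
  refine ⟨(q.map Prod.snd)[r * L.length + i], ?_, ?_, ?_, ?_⟩
  · rw [← hset, List.mem_toFinset]; exact List.getElem_mem _
  · rw [rrRow, hidx, hdiv]
  · rw [rrCol, hidx, hmod]
  · have h1 := hq.val_le hr ht'
    have h2 := hq.fst_getElem (t := r * L.length + i) (by omega) (by omega)
    simp only [hmod] at h2
    rw [h2] at h1
    have h3 : g = q[(q.map Prod.snd).idxOf g].2 := by
      rw [← List.getElem_map Prod.snd (h := ht), List.getElem_idxOf ht]
    rw [List.getElem_map]
    rw [← h3] at h1
    exact h1

/-- If the first `d` agents leave with all items but those in rows `2, 3, …` of the other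
columns, Round-Robin gives each of the others the rest of her column. -/
theorem partOf_roundRobin_drop {L : List (Fin n)} (hL : L.Nodup) (U : Finset (Fin m)) (d : ℕ)
    {c : ℕ} (hc : d + c < L.length) :
    let p := I.roundRobin L U
    let V := U.filter fun g => d ≤ rrCol L.length p g ∧ 2 ≤ rrRow L.length p g
    partOf V (rrCol (L.drop d).length (I.roundRobin (L.drop d) V)) c =
      U.filter fun g => rrCol L.length p g = d + c ∧ 2 ≤ rrRow L.length p g := by
  intro p V
  obtain ⟨q, hq, hmap, hset⟩ := I.exists_isRoundRobin _ L U (List.ne_nil_of_length_pos (by omega)) rfl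
  have hp : p = q.map Prod.snd := hmap.symm
  have hfilter : L.filter (fun a => decide (a ∈ L.drop d)) = L.drop d := by
    conv_lhs => rw [← List.take_append_drop d L]
    rw [List.filter_append, List.filter_eq_nil_iff.2, List.filter_eq_self.2, List.nil_append]
    · simp
    · intro a ha
      simpa using List.disjoint_take_drop hL le_rfl ha
  have hrow (g : Fin m) : 2 * L.length ≤ p.idxOf g ↔ 2 ≤ rrRow L.length p g := by
    rw [rrRow, Nat.le_div_iff_mul_le (by omega)]
  -- Two full rounds bring the picking sequence back to `L`, so deleting the first two rows and then
  -- the departed agents leaves a run with sequence `L.drop d`.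
  have hq' := (hq.drop (L.length * 2)).filter fun a => decide (a ∈ L.drop d)
  rw [List.rotate_length_mul, hfilter, mul_comm] at hq'
  set q' := (q.drop (2 * L.length)).filter fun x => decide (x.1 ∈ L.drop d) with hq'_def
  have hmem (e : ℕ) (he : d + e < L.length) (g : Fin m) :
      (L[d + e], g) ∈ q' ↔ g ∈ U ∧ rrCol L.length p g = d + e ∧ 2 ≤ rrRow L.length p g := by
    rw [hq'_def, List.mem_filter, hq.mem_drop_iff hL he, ← hp, hrow]
    have h1 : L[d + e] ∈ L.drop d := List.mem_drop_iff_getElem.2 ⟨e, by omega, rfl⟩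
    have h2 : g ∈ p ↔ g ∈ U := mem_roundRobin (List.ne_nil_of_length_pos (by omega))
    simp [h1, h2]
  have hV : (q'.map Prod.snd).toFinset = V := by
    ext g
    rw [List.mem_toFinset, List.mem_map, Finset.mem_filter]
    constructor
    · rintro ⟨⟨a, g⟩, hx, rfl⟩
      have ha : a ∈ L.drop d := by
        simpa using (List.mem_filter.1 hx).2
      obtain ⟨e, he, rfl⟩ := List.mem_drop_iff_getElem.1 ha
      obtain ⟨h1, h2, h3⟩ := (hmem e (by omega) g).1 hx
      exact ⟨h1, (Nat.le_add_right d e).trans h2.ge, h3⟩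
    · rintro ⟨h1, h2, h3⟩
      have hlt : rrCol L.length p g < L.length := Nat.mod_lt _ (by omega)
      exact ⟨_, (hmem (rrCol L.length p g - d) (by omega) g).2 ⟨h1, by omega, h3⟩, rfl⟩
  ext g
  have h1 := hq'.mem_drop_iff (hL.sublist (List.drop_sublist _ _)) (c := c)
    (by rw [List.length_drop]; omega) 0 g
  rw [List.drop_zero, List.getElem_drop, hmem c hc, ← List.mem_toFinset, hV] at h1
  have hrr : I.roundRobin (L.drop d) V = q'.map Prod.snd := by rw [← hV, hq'.roundRobin_eq]
  rw [hrr]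
  simp only [zero_le, and_true] at h1
  rw [Finset.mem_filter, h1]
  exact Finset.mem_filter

end FairInstance

/-! ### One stage -/

theorem eq_of_rrRow_of_rrCol {m N : ℕ} {picks : List (Fin m)} {g h : Fin m} (hg : g ∈ picks)
    (hr : rrRow N picks g = rrRow N picks h) (hc : rrCol N picks g = rrCol N picks h) :
    g = h := by
  refine (List.idxOf_inj hg).1 ?_
  rw [← Nat.div_add_mod (picks.idxOf g) N, ← Nat.div_add_mod (picks.idxOf h) N]
  unfold rrRow at hr
  unfold rrCol at hc
  rw [hr, hc]

theorem rrRow_mul_add_rrCol {m : ℕ} (N : ℕ) (picks : List (Fin m)) (g : Fin m) :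
    rrRow N picks g * N + rrCol N picks g = picks.idxOf g :=
  Nat.div_add_mod' _ _

namespace FairInstance

variable {n m : ℕ} {I : FairInstance n m}

theorem value_mono (a : Fin n) {S T : Finset (Fin m)} (h : S ⊆ T) : I.value a S ≤ I.value a T :=
  Finset.sum_le_sum_of_subset_of_nonneg h fun _ _ _ => I.val_nonneg _ _

theorem value_nonneg (a : Fin n) (S : Finset (Fin m)) : 0 ≤ I.value a S :=
  Finset.sum_nonneg fun _ _ => I.val_nonneg _ _

theorem value_le_card (a : Fin n) (S : Finset (Fin m)) : I.value a S ≤ S.card := by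
  simpa [value] using Finset.sum_le_card_nsmul S (I.val a) 1 fun g _ => I.val_le_one a g

theorem value_lt_of_notMem {a : Fin n} {S T : Finset (Fin m)} {g : Fin m} (h : S ⊆ T)
    (hgT : g ∈ T) (hgS : g ∉ S) (hg : 0 < I.val a g) : I.value a S < I.value a T :=
  Finset.sum_lt_sum_of_subset h hgT hgS hg fun _ _ _ => I.val_nonneg _ _

/-- A set of items is worth at most what column `i` is worth, restricted to the rows that
the items of positive value are assigned to. -/
theorem Dominates.value_le {a : Fin n} {N i : ℕ} {picks : List (Fin m)} {U : Finset (Fin m)}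
    (hdom : I.Dominates a N i picks U) {S : Finset (Fin m)} (hS : S ⊆ U) (f : Fin m → ℕ)
    (hinj : ∀ g ∈ S, ∀ h ∈ S, 0 < I.val a g → 0 < I.val a h → f g = f h → g = h)
    (hf : ∀ g ∈ S, 0 < I.val a g → f g * N + i ≤ picks.idxOf g) :
    I.value a S ≤ I.value a ((partOf U (rrCol N picks) i).filter fun h =>
      ∃ g ∈ S, 0 < I.val a g ∧ f g = rrRow N picks h) := by
  classical
  -- `φ g` is the item of column `i` in row `f g`. Worthless items need not satisfy `hf`; for them
  -- the value of `φ` is irrelevant.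
  have hex : ∀ g, ∃ h, g ∈ S → 0 < I.val a g →
      h ∈ U ∧ rrRow N picks h = f g ∧ rrCol N picks h = i ∧ I.val a g ≤ I.val a h := by
    intro g
    by_cases hg : g ∈ S ∧ 0 < I.val a g
    · obtain ⟨h, hh⟩ := hdom g (hS hg.1) (f g) (hf g hg.1 hg.2)
      exact ⟨h, fun _ _ => hh⟩
    · exact ⟨g, fun h1 h2 => absurd ⟨h1, h2⟩ hg⟩
  choose φ hφ using hex
  have h1 : I.value a S = I.value a (S.filter fun g => 0 < I.val a g) := by
    refine (Finset.sum_filter_of_ne fun g _ hg => ?_).symm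
    exact lt_of_le_of_ne (I.val_nonneg a g) (Ne.symm hg)
  have hφinj : Set.InjOn φ (S.filter fun g => 0 < I.val a g) := by
    intro g hg h hh hgh
    simp only [Finset.coe_filter, Set.mem_ofPred_eq] at hg hh
    refine hinj g hg.1 h hh.1 hg.2 hh.2 ?_
    rw [← (hφ g hg.1 hg.2).2.1, ← (hφ h hh.1 hh.2).2.1, hgh]
  calc I.value a S = ∑ g ∈ S.filter fun g => 0 < I.val a g, I.val a g := h1
    _ ≤ ∑ g ∈ S.filter fun g => 0 < I.val a g, I.val a (φ g) := by
        refine Finset.sum_le_sum fun g hg => ?_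
        rw [Finset.mem_filter] at hg
        exact (hφ g hg.1 hg.2).2.2.2
    _ = I.value a ((S.filter fun g => 0 < I.val a g).image φ) := (Finset.sum_image hφinj).symm
    _ ≤ _ := by
        refine value_mono a fun h hh => ?_
        obtain ⟨g, hg, rfl⟩ := Finset.mem_image.1 hh
        rw [Finset.mem_filter] at hg
        obtain ⟨h1, h2, h3, -⟩ := hφ g hg.1 hg.2
        simp only [partOf, Finset.mem_filter]
        exact ⟨⟨h1, h3⟩, g, hg.1, hg.2, h2.symm⟩

/-- If column `i` is worth more than `1`, its items in the first two rows have positive value. -/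
theorem Dominates.exists_pos {a : Fin n} {N i : ℕ} {picks : List (Fin m)} {U : Finset (Fin m)}
    (hdom : I.Dominates a N i picks U) (hU : ∀ g ∈ U, g ∈ picks)
    (h : 1 < I.value a (partOf U (rrCol N picks) i)) {r : ℕ} (hr : r < 2) :
    ∃ g ∈ U, rrRow N picks g = r ∧ rrCol N picks g = i ∧ 0 < I.val a g := by
  obtain ⟨g, hg, hrow, hpos⟩ : ∃ g ∈ partOf U (rrCol N picks) i,
      1 ≤ rrRow N picks g ∧ 0 < I.val a g := by
    -- Otherwise all the value of the column lies in its single top item, which is worth at most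
    -- `1`.
    by_contra! hcon
    have h1 : I.value a (partOf U (rrCol N picks) i) =
        I.value a ((partOf U (rrCol N picks) i).filter fun g => rrRow N picks g = 0) := by
      refine (Finset.sum_filter_of_ne fun g hg hne => ?_).symm
      by_contra h0
      exact hne (le_antisymm (hcon g hg (by omega)) (I.val_nonneg a g))
    have h2 : ((partOf U (rrCol N picks) i).filter fun g => rrRow N picks g = 0).card ≤ 1 := by
      rw [Finset.card_le_one]
      intro g hg h hh
      simp only [partOf, Finset.mem_filter] at hg hh
      exact eq_of_rrRow_of_rrCol (hU g hg.1.1) (hg.2.trans hh.2.symm) (hg.1.2.trans hh.1.2.symm)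
    have h3 := value_le_card (I := I) a
      ((partOf U (rrCol N picks) i).filter fun g => rrRow N picks g = 0)
    have h4 : ((((partOf U (rrCol N picks) i).filter fun g => rrRow N picks g = 0).card : ℕ) : ℝ)
      ≤ 1 := by exact_mod_cast h2
    linarith
  rw [partOf, Finset.mem_filter] at hg
  obtain ⟨h, hhU, h1, h2, h3⟩ := hdom g hg.1 r (by
    rw [← rrRow_mul_add_rrCol N picks g, hg.2]
    have : r ≤ rrRow N picks g := by omega
    gcongr)
  exact ⟨h, hhU, h1, h2, hpos.trans_le h3⟩

/-- The situation when the agent with number `i` arrives, all agents before her having taken their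
own parts: only donor items have been moved, to the parts of these agents. -/
def StageInv (N : ℕ) (picks : List (Fin m)) (U : Finset (Fin m)) (i : ℕ) (own : Fin m → ℕ) :
    Prop :=
  ∀ g ∈ U, own g = rrCol N picks g ∨
    (rrRow N picks g < 2 ∧ N / 2 ≤ rrCol N picks g ∧ own g < i)

theorem Rational.choose_eq {choose : ChoiceRule n m} (hch : I.Rational choose) {a : Fin n}
    {A : Finset ℕ} {P : ℕ → Finset (Fin m)} {i : ℕ} (hi : i ∈ A)
    (h : ∀ q ∈ A, q ≠ i → I.value a (P q) < I.value a (P i)) : choose a A P = i := by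
  by_contra hne
  obtain ⟨h1, h2⟩ := hch a A P ⟨i, hi⟩
  exact absurd (h2 i hi) (not_le.2 (h _ h1 hne))

/-- An agent who values her column at more than `1` strictly prefers the part with her number. -/
theorem prepare_spec {a : Fin n} {N i : ℕ} {picks : List (Fin m)} {U : Finset (Fin m)}
    {own : Fin m → ℕ} (hU : ∀ g ∈ U, g ∈ picks) (hdom : I.Dominates a N i picks U)
    (h1 : 1 < I.value a (partOf U (rrCol N picks) i)) (hi : i < N / 2)
    (hinv : StageInv N picks U i own) :
    (∀ q ∈ Finset.Ico i N, q ≠ i →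
      I.value a (partOf U (I.prepare N picks U i a own (Finset.Ico i N)).2 q) <
        I.value a (partOf U (I.prepare N picks U i a own (Finset.Ico i N)).2 i)) ∧
    I.value a (partOf U (rrCol N picks) i) ≤
      I.value a (partOf U (I.prepare N picks U i a own (Finset.Ico i N)).2 i) ∧
    StageInv N picks U (i + 1) (I.prepare N picks U i a own (Finset.Ico i N)).1 ∧
    (i + 1 = N / 2 → ∀ g ∈ U, rrRow N picks g < 2 → N / 2 ≤ rrCol N picks g →
      (I.prepare N picks U i a own (Finset.Ico i N)).1 g < N / 2) := by
  classical
  have hiA : i ∈ Finset.Ico i N := by rw [Finset.mem_Ico]; omega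
  have hcolN (g : Fin m) : rrCol N picks g < N := Nat.mod_lt _ (by omega)
  have hidx (g : Fin m) := rrRow_mul_add_rrCol N picks g
  have hinv' : StageInv N picks U (i + 1) own := fun g hg =>
    (hinv g hg).imp_right fun ⟨h1, h2, h3⟩ => ⟨h1, h2, by omega⟩
  -- A set with distinct rows and columns right of `i` that misses one of the first two rows.
  have hlt : ∀ S ⊆ U, ∀ r < 2,
      (∀ g ∈ S, 0 < I.val a g → i ≤ rrCol N picks g ∧ rrRow N picks g ≠ r) →
      (∀ g ∈ S, ∀ h ∈ S, 0 < I.val a g → 0 < I.val a h → rrRow N picks g = rrRow N picks h →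
        rrCol N picks g = rrCol N picks h) →
      I.value a S < I.value a (partOf U (rrCol N picks) i) := by
    intro S hS r hr hrow hinj
    refine (hdom.value_le hS (rrRow N picks) (fun g hg h hh hg0 hh0 hgh =>
      eq_of_rrRow_of_rrCol (hU g (hS hg)) hgh (hinj g hg h hh hg0 hh0 hgh))
      (fun g hg hg0 => ?_)).trans_lt ?_
    · rw [← hidx g]; have := (hrow g hg hg0).1; omega
    · obtain ⟨h, hhU, hhr, hhc, hh0⟩ := hdom.exists_pos hU h1 hr
      refine value_lt_of_notMem (Finset.filter_subset _ _)
        (Finset.mem_filter.2 ⟨hhU, hhc⟩ : h ∈ partOf U (rrCol N picks) i) ?_ hh0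
      rw [Finset.mem_filter]
      rintro ⟨-, g, hg, hg0, hgr⟩
      exact (hrow g hg hg0).2 (hgr.trans hhr)
  rw [prepare, if_neg (not_not.2 hiA)]
  split_ifs with hmid
  · -- the last agent of the stage gets all donor items
    set M : Fin m → ℕ := fun g => if IsDonor N picks U own (Finset.Ico i N) g then i else own g
      with hM
    have hMdon : ∀ g ∈ U, rrRow N picks g < 2 → N / 2 ≤ rrCol N picks g → M g < N / 2 := by
      intro g hg hr hc
      simp only [hM]
      split_ifs with hd
      · omega
      · rcases hinv g hg with h | h
        · refine absurd ⟨⟨hg, h, ?_⟩, hr, hc⟩ hd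
          have := hcolN g
          rw [Finset.mem_Ico]; omega
        · omega
    have hsub : partOf U (rrCol N picks) i ⊆ partOf U M i := by
      intro g hg
      rw [partOf, Finset.mem_filter] at hg ⊢
      refine ⟨hg.1, ?_⟩
      simp only [hM]
      split_ifs with hd
      · rfl
      · rcases hinv g hg.1 with h | h <;> omega
    refine ⟨fun q hq hqi => ?_, value_mono a hsub, fun g hg => ?_, fun _ => hMdon⟩
    · rw [Finset.mem_Ico] at hq
      -- All donor items have gone to the parts below `N / 2`, so every other part on offer lacks
      -- rows `0` and `1`.
      have hpart : ∀ g ∈ partOf U M q, rrCol N picks g = q ∧ 2 ≤ rrRow N picks g := by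
        intro g hg
        rw [partOf, Finset.mem_filter] at hg
        have hown : own g = q := by
          have := hg.2
          simp only [hM] at this
          split_ifs at this
          · omega
          · exact this
        rcases hinv g hg.1 with h | h
        · refine ⟨by omega, ?_⟩
          by_contra hr
          have := hMdon g hg.1 (by omega) (by omega)
          omega
        · omega
      refine lt_of_lt_of_le (hlt _ (Finset.filter_subset _ _) 0 (by omega) ?_ ?_)
        (value_mono a hsub)
      · intro g hg _
        have := hpart g hg
        omega
      · intro g hg h hh _ _ _
        rw [(hpart g hg).1, (hpart h hh).1]
    · simp only [hM]
      split_ifs with hd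
      · exact Or.inr ⟨hd.2.1, hd.2.2, by omega⟩
      · exact hinv' g hg
  · have hparti : ∀ g ∈ U, rrCol N picks g = i → own g = i := by
      intro g hg hc
      rcases hinv g hg with h | h <;> omega
    have hown (q : ℕ) (hq : i ≤ q) : ∀ g ∈ U, own g = q → rrCol N picks g = q := by
      intro g hg hc
      rcases hinv g hg with h | h <;> omega
    split
    next g₀ hg₀ =>
      -- agent `i` gets a donor item of positive value
      have hg₀' := List.find?_some hg₀
      simp only [decide_eq_true_eq] at hg₀'
      obtain ⟨⟨⟨hg₀U, hg₀own, hg₀A⟩, hg₀r, hg₀c⟩, hpos⟩ := hg₀'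
      have hsub : partOf U (rrCol N picks) i ⊆ partOf U (Function.update own g₀ i) i := by
        intro g hg
        rw [partOf, Finset.mem_filter] at hg ⊢
        refine ⟨hg.1, ?_⟩
        rw [Function.update_apply]
        split_ifs
        · rfl
        · exact hparti g hg.1 hg.2
      refine ⟨fun q hq hqi => ?_, value_mono a hsub, fun g hg => ?_, fun h => absurd h hmid⟩
      · rw [Finset.mem_Ico] at hq
        have hpart : ∀ g ∈ partOf U (Function.update own g₀ i) q, rrCol N picks g = q := by
          intro g hg
          rw [partOf, Finset.mem_filter, Function.update_apply] at hg
          split_ifs at hg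
          · omega
          · exact hown q hq.1 g hg.1 hg.2
        -- The other parts lie within their columns, hence are worth at most column `i`. Strictness
        -- comes from `g₀`, which part `i` has on top of its column.
        refine lt_of_le_of_lt ((hdom.value_le (Finset.filter_subset _ _) (rrRow N picks)
          (fun g hg h hh _ _ hgh => eq_of_rrRow_of_rrCol (hU g (Finset.filter_subset _ _ hg)) hgh
            (by rw [hpart g hg, hpart h hh])) (fun g hg _ => ?_)).trans
          (value_mono a (Finset.filter_subset _ _))) (value_lt_of_notMem hsub (g := g₀) ?_ ?_ hpos)
        · have := hpart g hg
          rw [← hidx g]; omega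
        · simp [partOf, hg₀U]
        · rw [partOf, Finset.mem_filter]; omega
      · simp only [Function.update_apply]
        split_ifs with hgg
        · subst hgg; exact Or.inr ⟨hg₀r, hg₀c, by omega⟩
        · exact hinv' g hg
    next hnone =>
      -- No donor item has positive value to `a`. After the exchange, the parts `q` with `i < q < N
      -- / 2` thus have nothing of value in row `0`, and those with `N / 2 ≤ q` nothing in row `1`.
      have hzero : ∀ g ∈ U, rrRow N picks g < 2 → N / 2 ≤ rrCol N picks g →
          own g = rrCol N picks g → 0 < I.val a g → False := by
        intro g hg hr hc ho hpos
        have := List.find?_eq_none.1 hnone g (List.mem_finRange g)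
        simp only [decide_eq_true_eq] at this
        refine this ⟨⟨⟨hg, ho, ?_⟩, hr, hc⟩, hpos⟩
        have := hcolN g
        rw [Finset.mem_Ico]; omega
      set R := rebundle N i picks U own (Finset.Ico i N) with hR
      have hsub : partOf U (rrCol N picks) i ⊆ partOf U R i := by
        intro g hg
        rw [partOf, Finset.mem_filter] at hg ⊢
        refine ⟨hg.1, ?_⟩
        have h1 := hparti g hg.1 hg.2
        simp only [hR, rebundle, swapLabel, h1]
        split_ifs <;> omega
      refine ⟨fun q hq hqi => ?_, value_mono a hsub, hinv', fun h => absurd h hmid⟩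
      rw [Finset.mem_Ico] at hq
      -- the items of positive value in part `q`
      have hpart : ∀ g ∈ partOf U R q, 0 < I.val a g →
          (q < N / 2 ∧ rrCol N picks g = q ∧ 1 ≤ rrRow N picks g) ∨
          (N / 2 ≤ q ∧ ((rrCol N picks g = q ∧ 2 ≤ rrRow N picks g) ∨
            (rrCol N picks g = i + (q - N / 2) + 1 ∧ rrRow N picks g = 0))) := by
        intro g hg hpos
        rw [partOf, Finset.mem_filter] at hg
        obtain ⟨hgU, hgq⟩ := hg
        have hz : ¬(rrRow N picks g < 2 ∧ N / 2 ≤ rrCol N picks g ∧ own g = rrCol N picks g) :=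
          fun h => hzero g hgU h.1 h.2.1 h.2.2 hpos
        have hi := hinv g hgU
        have hcN := hcolN g
        -- Both parts of every exchanged pair are still on offer, so no exchange is suppressed.
        have hswap (c : ℕ) (hc : c ∈ Finset.Ico i N) :
            swapLabel (N / 2) i c ∈ Finset.Ico i N := by
          rw [Finset.mem_Ico] at hc ⊢
          unfold swapLabel
          split_ifs <;> omega
        simp only [hR, rebundle] at hgq
        split_ifs at hgq with hcond
        · obtain ⟨⟨-, ho, -⟩, hr, -⟩ := hcond
          unfold swapLabel at hgq
          split_ifs at hgq <;> omega
        · have ho : own g = rrCol N picks g := by omega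
          have hA : own g ∈ Finset.Ico i N := by rw [Finset.mem_Ico]; omega
          have hr : rrRow N picks g ≠ 0 := fun h => hcond ⟨⟨hgU, ho, hA⟩, h, hswap _ hA⟩
          omega
      by_cases hqm : q < N / 2
      · refine lt_of_lt_of_le (hlt _ (Finset.filter_subset _ _) 0 (by omega) ?_ ?_)
          (value_mono a hsub)
        · intro g hg hpos
          have := hpart g hg hpos
          omega
        · intro g hg h hh hg0 hh0 _
          have h1 := hpart g hg hg0
          have h2 := hpart h hh hh0
          omega
      · refine lt_of_lt_of_le (hlt _ (Finset.filter_subset _ _) 1 (by omega) ?_ ?_)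
          (value_mono a hsub)
        · intro g hg hpos
          have := hpart g hg hpos
          omega
        · intro g hg h hh hg0 hh0 _
          have h1 := hpart g hg hg0
          have h2 := hpart h hh hh0
          omega

end FairInstance

/-! ### The whole algorithm -/

namespace FairInstance

variable {n m : ℕ} {I : FairInstance n m}

theorem length_pickingPhase (choose : ChoiceRule n m) (N : ℕ) (picks : List (Fin m))
    (U : Finset (Fin m)) : ∀ (rest : List (Fin n)) (i : ℕ) (own : Fin m → ℕ) (A : Finset ℕ),
      (I.pickingPhase choose N picks U rest i own A).1.length = rest.length
  | [], _, _, _ => by simp [pickingPhase]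
  | a :: rest, i, own, A => by
    simp [pickingPhase, length_pickingPhase choose N picks U rest]

/-- As long as the agents value their columns at more than `1`, each takes the part with her number.
If all agents of the stage do so, the rows `2, 3, …` of the other columns are left over. -/
theorem pickingPhase_spec {choose : ChoiceRule n m} (hch : I.Rational choose) {N : ℕ}
    {picks : List (Fin m)} {U : Finset (Fin m)} (hU : ∀ g ∈ U, g ∈ picks) :
    ∀ (rest : List (Fin n)) (i : ℕ) (own : Fin m → ℕ), rest.length + i = N / 2 →
      StageInv N picks U i own →
      (∀ k (hk : k < rest.length), I.Dominates rest[k] N (i + k) picks U) →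
      (∀ k (hk : k < rest.length),
        (∀ j (hj : j ≤ k), 1 < I.value rest[j] (partOf U (rrCol N picks) (i + j))) →
        I.value rest[k] (partOf U (rrCol N picks) (i + k)) ≤ I.value rest[k]
          ((I.pickingPhase choose N picks U rest i own (Finset.Ico i N)).1.getD k ∅)) ∧
      ((∀ j (hj : j < rest.length), 1 < I.value rest[j] (partOf U (rrCol N picks) (i + j))) →
        (i = N / 2 → ∀ g ∈ U, rrRow N picks g < 2 → N / 2 ≤ rrCol N picks g → own g < N / 2) →
        (I.pickingPhase choose N picks U rest i own (Finset.Ico i N)).2 =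
          U.filter fun g => N / 2 ≤ rrCol N picks g ∧ 2 ≤ rrRow N picks g)
  | [], i, own, hlen, hinv, _ => by
    refine ⟨fun k hk => by simp at hk, fun _ hdon => ?_⟩
    rw [List.length_nil, zero_add] at hlen
    have hdon := hdon hlen
    rw [pickingPhase]
    refine Finset.filter_congr fun g hg => ?_
    have hd := hdon g hg
    rw [Finset.mem_Ico]
    -- For `N = 0`, division by zero puts every item in row `0`, and `hd` becomes contradictory.
    rcases Nat.eq_zero_or_pos N with rfl | hN
    · rcases hinv g hg with h | h
      · simp only [rrRow, Nat.div_zero] at *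
        omega
      · omega
    · have hlt : rrCol N picks g < N := Nat.mod_lt _ hN
      rcases hinv g hg with h | h <;> omega
  | a :: rest, i, own, hlen, hinv, hdom => by
    rw [List.length_cons] at hlen
    have herase : (Finset.Ico i N).erase i = Finset.Ico (i + 1) N := by
      ext x; simp only [Finset.mem_erase, Finset.mem_Ico]; omega
    have hdom0 : I.Dominates a N i picks U := hdom 0 (by simp)
    have hsucc (j : ℕ) : i + (j + 1) = i + 1 + j := by omega
    have hkey (h1 : 1 < I.value a (partOf U (rrCol N picks) i)) :=
      prepare_spec hU hdom0 h1 (by omega) hinv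
    have hunfold (h1 : 1 < I.value a (partOf U (rrCol N picks) i)) :
        I.pickingPhase choose N picks U (a :: rest) i own (Finset.Ico i N) =
          let MM := I.prepare N picks U i a own (Finset.Ico i N)
          let r := I.pickingPhase choose N picks U rest (i + 1) MM.1 (Finset.Ico (i + 1) N)
          (partOf U MM.2 i :: r.1, r.2) := by
      -- Since the agent takes label `i`, the permanent partition is the one carried on.
      have hq := hch.choose_eq (Finset.mem_Ico.2 ⟨le_rfl, by omega⟩) (hkey h1).1
      simp only [pickingPhase, hq, herase, if_true]
    have ih (h1 : 1 < I.value a (partOf U (rrCol N picks) i)) :=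
      pickingPhase_spec hch hU rest (i + 1) (I.prepare N picks U i a own (Finset.Ico i N)).1
        (by omega) (hkey h1).2.2.1 (fun k hk => by
          rw [← hsucc]
          exact hdom (k + 1) (by simpa using hk))
    refine ⟨fun k hk hrich => ?_, fun hrich hdon => ?_⟩
    · have h1 : 1 < I.value a (partOf U (rrCol N picks) i) := hrich 0 (by omega)
      rw [hunfold h1]
      rcases k with _ | k
      · exact (hkey h1).2.1
      · have := (ih h1).1 k (by simpa using hk) (fun j hj => by
          rw [← hsucc]
          exact hrich (j + 1) (by omega))
        rw [← hsucc] at this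
        exact this
    · have h1 : 1 < I.value a (partOf U (rrCol N picks) i) := hrich 0 (by simp)
      rw [hunfold h1]
      exact (ih h1).2 (fun j hj => by
        rw [← hsucc]
        exact hrich (j + 1) (by simpa using hj))
        (hkey h1).2.2.2

/-- The items that Round-Robin on `U` with picking sequence `L` gives to number `i` of `L`. -/
noncomputable def column (I : FairInstance n m) (L : List (Fin n)) (U : Finset (Fin m)) (i : ℕ) :
    Finset (Fin m) :=
  partOf U (rrCol L.length (I.roundRobin L U)) i

theorem card_filter_row_column_le_one {L : List (Fin n)} (hL : L ≠ []) (U : Finset (Fin m))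
    (i r : ℕ) :
    ((I.column L U i).filter fun g => rrRow L.length (I.roundRobin L U) g = r).card ≤ 1 := by
  rw [Finset.card_le_one]
  intro g hg h hh
  simp only [column, partOf, Finset.mem_filter] at hg hh
  exact eq_of_rrRow_of_rrCol ((mem_roundRobin hL).2 hg.1.1) (hg.2.trans hh.2.symm)
    (hg.1.2.trans hh.1.2.symm)

/-- Envy-freeness up to one item: drop the top item of column `c` and compare its row `r + 1` with
row `r` of column `i`, which is picked earlier. -/
theorem value_column_le_add_one {L : List (Fin n)} (U : Finset (Fin m)) {i : ℕ}
    (hi : i < L.length) (c : ℕ) :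
    I.value L[i] (I.column L U c) ≤ I.value L[i] (I.column L U i) + 1 := by
  classical
  have hL : L ≠ [] := List.ne_nil_of_length_pos (by omega)
  set p := I.roundRobin L U with hp
  have hsplit := Finset.sum_filter_add_sum_filter_not (I.column L U c)
    (fun g => rrRow L.length p g = 0) (I.val L[i])
  have h0 : I.value L[i] ((I.column L U c).filter fun g => rrRow L.length p g = 0) ≤ 1 :=
    (value_le_card _ _).trans (by exact_mod_cast card_filter_row_column_le_one hL U c 0)
  have h1 : I.value L[i] ((I.column L U c).filter fun g => ¬rrRow L.length p g = 0) ≤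
      I.value L[i] (I.column L U i) := by
    refine ((dominates_roundRobin U hi).value_le ((Finset.filter_subset _ _).trans
      (Finset.filter_subset _ _)) (fun g => rrRow L.length p g - 1) ?_ ?_).trans
      (value_mono _ (Finset.filter_subset _ _))
    · intro g hg h hh _ _ hgh
      simp only [Finset.mem_filter, ← hp] at hg hh
      exact eq_of_rrRow_of_rrCol (N := L.length) (picks := p) ((mem_roundRobin hL).2 hg.1.1)
        (by omega) (hg.1.2.trans hh.1.2.symm)
    · intro g hg _
      rw [Finset.mem_filter] at hg
      rw [← hp, ← rrRow_mul_add_rrCol L.length p g]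
      obtain ⟨r, hr⟩ := Nat.exists_eq_succ_of_ne_zero hg.2
      rw [hr, Nat.succ_sub_one, Nat.succ_mul]
      omega
  unfold value at *
  linarith

theorem value_le_length_mul {L : List (Fin n)} (U : Finset (Fin m)) {i : ℕ}
    (hi : i < L.length) :
    I.value L[i] U ≤ L.length * (I.value L[i] (I.column L U i) + 1) := by
  have h1 : I.value L[i] U = ∑ c ∈ Finset.range L.length, I.value L[i] (I.column L U c) :=
    (Finset.sum_fiberwise_of_maps_to (fun g _ => Finset.mem_range.2
      (Nat.mod_lt ((I.roundRobin L U).idxOf g) (by omega))) _).symm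
  rw [h1]
  simpa [mul_add] using Finset.sum_le_card_nsmul (Finset.range L.length) _ _
    fun c _ => value_column_le_add_one (I := I) U hi c

/-! ### The stage function -/

theorem one_le_stageOf (N i : ℕ) : 1 ≤ stageOf N i := by
  unfold stageOf
  split_ifs <;> omega

theorem stageOf_of_le {N i : ℕ} (hi : i ≤ N / 2) : stageOf N i = 1 := by
  unfold stageOf
  split_ifs <;> rfl

theorem stageOf_of_lt {N i : ℕ} (hN : 1 < N) (hi : N / 2 < i) :
    stageOf N i = 1 + stageOf (N - N / 2) (i - N / 2) := by
  rw [stageOf, if_neg (by omega), if_neg (by omega)]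

theorem stageOf_mono (N : ℕ) : Monotone (stageOf N) := by
  induction N using Nat.strong_induction_on with
  | _ N ih =>
    intro i j hij
    by_cases hi : i ≤ N / 2
    · rw [stageOf_of_le hi]; exact one_le_stageOf N j
    · by_cases hN : N ≤ 1
      · unfold stageOf; simp [hN]
      · rw [stageOf_of_lt (N := N) (i := i) (by omega) (by omega),
          stageOf_of_lt (N := N) (i := j) (by omega) (by omega)]
        exact Nat.add_le_add_left (ih (N - N / 2) (by omega) (by omega)) 1

/-- After a stage in which all agents took their own parts, an agent who stays loses at most
two items of her column. -/
theorem value_column_sub_two_le {L : List (Fin n)} (hL : L.Nodup) (U : Finset (Fin m)) (d : ℕ)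
    {c : ℕ} (hc : d + c < L.length) (a : Fin n) :
    I.value a (I.column L U (d + c)) - 2 ≤ I.value a (I.column (L.drop d)
      (U.filter fun g => d ≤ rrCol L.length (I.roundRobin L U) g ∧
        2 ≤ rrRow L.length (I.roundRobin L U) g) c) := by
  have hne : L ≠ [] := List.ne_nil_of_length_pos (by omega)
  have hcol := partOf_roundRobin_drop (I := I) hL U d hc
  simp only at hcol
  set p := I.roundRobin L U with hp
  have hr (r : ℕ) : I.value a ((I.column L U (d + c)).filter fun g => rrRow L.length p g = r) ≤ 1 :=
    (value_le_card _ _).trans (by exact_mod_cast card_filter_row_column_le_one hne U (d + c) r)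
  have hsub : I.column L U (d + c) ⊆
      (((I.column L U (d + c)).filter fun g => rrRow L.length p g = 0) ∪
      ((I.column L U (d + c)).filter fun g => rrRow L.length p g = 1)) ∪
      (U.filter fun g => rrCol L.length p g = d + c ∧ 2 ≤ rrRow L.length p g) := by
    intro g hg
    have hg' := hg
    rw [column, partOf, Finset.mem_filter, ← hp] at hg'
    simp only [Finset.mem_union, Finset.mem_filter, hg, true_and, hg'.1, hg'.2]
    omega
  have hunion (S T : Finset (Fin m)) : I.value a (S ∪ T) ≤ I.value a S + I.value a T := by
    have := Finset.sum_union_inter (s₁ := S) (s₂ := T) (f := I.val a)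
    have h0 := value_nonneg (I := I) a (S ∩ T)
    unfold value at *
    linarith
  rw [column.eq_1 I (L.drop d), hcol]
  have h1 := value_mono (I := I) a hsub
  have h2 := hunion (((I.column L U (d + c)).filter fun g => rrRow L.length p g = 0) ∪
      ((I.column L U (d + c)).filter fun g => rrRow L.length p g = 1))
      (U.filter fun g => rrCol L.length p g = d + c ∧ 2 ≤ rrRow L.length p g)
  have h3 := hunion ((I.column L U (d + c)).filter fun g => rrRow L.length p g = 0)
      ((I.column L U (d + c)).filter fun g => rrRow L.length p g = 1)
  linarith [hr 0, hr 1]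

/-- The threshold `2 g - 1` is at least `1`, as the current stage needs, and it falls by `2` with
each stage, just as the column may. Only the agents up to `i` have to be rich, because what `i`
receives does not depend on later choices. -/
theorem boundedProp_spec {choose : ChoiceRule n m} (hch : I.Rational choose) (N : ℕ) :
    ∀ (L : List (Fin n)) (U : Finset (Fin m)), L.length = N → L.Nodup →
    ∀ i (hi : i < L.length),
      (∀ j (hj : j ≤ i), 2 * (stageOf N (j + 1) : ℝ) - 1 < I.value L[j] (I.column L U j)) →
      I.value L[i] (I.column L U i) - 2 * ((stageOf N (i + 1) : ℝ) - 1) ≤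
        I.value L[i] ((I.boundedProp choose L U).getD i ∅) := by
  induction N using Nat.strong_induction_on with
  | _ N ih =>
    intro L U hN hL i hi hrich
    have hne : L ≠ [] := List.ne_nil_of_length_pos (by omega)
    have hstage (k : ℕ) : (1 : ℝ) ≤ stageOf N k := by exact_mod_cast one_le_stageOf N k
    by_cases hN1 : L.length ≤ 1
    · rw [boundedProp, if_pos hN1, List.getD_eq_getElem _ _ (by simpa using hi), List.getElem_map]
      have hsub : I.column L U i ⊆ U := Finset.filter_subset _ _
      have := value_mono (I := I) L[i] hsub
      linarith [hstage (i + 1)]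
    · rw [boundedProp, if_neg hN1]
      simp only
      set p := I.roundRobin L U with hp
      set r := I.pickingPhase choose L.length p U (L.take (L.length / 2)) 0
        (rrCol L.length p) (Finset.range L.length) with hr
      have htake : (L.take (L.length / 2)).length = L.length / 2 := by
        rw [List.length_take]; omega
      have hlen : r.1.length = L.length / 2 := by rw [hr, length_pickingPhase, htake]
      obtain ⟨hval, hrest⟩ := pickingPhase_spec hch (N := L.length) (picks := p) (U := U)
        (fun g hg => (mem_roundRobin hne).2 hg) (L.take (L.length / 2)) 0 (rrCol L.length p)
        (by omega) (fun g _ => Or.inl rfl) (fun k hk => by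
          rw [List.getElem_take, zero_add]
          exact dominates_roundRobin U (by omega))
      rw [← Finset.range_eq_Ico, ← hr] at hval hrest
      have hfirst : ∀ j (hj : j ≤ i), j < L.length / 2 → 1 < I.value L[j] (I.column L U j) := by
        intro j hj _
        linarith [hrich j hj, hstage (j + 1)]
      by_cases himid : i < L.length / 2
      · rw [List.getD_append _ _ _ _ (by omega)]
        have := hval i (by omega) (fun j hj => by
          rw [List.getElem_take, zero_add]
          exact hfirst j hj (by omega))
        rw [List.getElem_take, zero_add] at this
        rw [stageOf_of_le (by omega)]
        unfold column
        simpa using this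
      · rw [List.getD_append_right _ _ _ _ (by omega), hlen, hrest (fun j hj => by
          rw [List.getElem_take, zero_add]
          exact hfirst j (by omega) (by omega)) (fun h => by omega)]
        obtain ⟨k, rfl⟩ := Nat.exists_eq_add_of_le (not_lt.1 himid)
        have hstep (j : ℕ) : stageOf N (L.length / 2 + j + 1) =
            1 + stageOf (N - N / 2) (j + 1) := by
          rw [stageOf_of_lt (by omega) (by omega)]
          congr 2
          omega
        have hcol (j : ℕ) (hj : L.length / 2 + j < L.length) :=
          value_column_sub_two_le (I := I) hL U (L.length / 2) hj L[L.length / 2 + j]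
        have := ih (N - N / 2) (by omega) (L.drop (L.length / 2)) (U.filter fun g =>
          L.length / 2 ≤ rrCol L.length p g ∧ 2 ≤ rrRow L.length p g)
          (by rw [List.length_drop]; omega) (hL.sublist (List.drop_sublist _ _)) k
          (by rw [List.length_drop]; omega) (fun j hj => by
            rw [List.getElem_drop]
            have h1 := hrich (L.length / 2 + j) (by omega)
            rw [hstep j] at h1
            have h2 := hcol j (by omega)
            push_cast at h1
            linarith)
        rw [List.getElem_drop] at this
        rw [hstep k, Nat.add_sub_cancel_left]
        have h2 := hcol k hi
        push_cast
        linarith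

/-- If the agents arrive in order of decreasing total value, each gets the guaranteed value. -/
theorem prop_sub_le_value_received {τ : Equiv.Perm (Fin n)}
    (hτ : ∀ i j, i ≤ j → I.value (τ j) Finset.univ ≤ I.value (τ i) Finset.univ)
    {choose : ChoiceRule n m} (hch : I.Rational choose) (i : Fin n) :
    I.prop (τ i) - 2 * (stageOf n ((i : ℕ) + 1) : ℝ) - 2 ≤
      I.value (τ i) (I.received choose τ i) := by
  have hn : (0 : ℝ) < n := by exact_mod_cast i.pos
  have hnonneg := value_nonneg (I := I) (τ i) (I.received choose τ i)
  -- For a poor agent the promised value is not positive.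
  by_cases hpoor : I.prop (τ i) ≤ 2 * (stageOf n ((i : ℕ) + 1) : ℝ) + 2
  · linarith
  have hlen : (List.ofFn τ).length = n := List.length_ofFn
  have hget (j : ℕ) (hj : j < (List.ofFn τ).length) :
      (List.ofFn τ)[j] = τ ⟨j, by omega⟩ := List.getElem_ofFn _
  have hcol (j : ℕ) (hj : j < n) : I.prop (τ ⟨j, hj⟩) - 1 ≤
      I.value (τ ⟨j, hj⟩) (I.column (List.ofFn τ) Finset.univ j) := by
    have := value_le_length_mul (I := I) (L := List.ofFn τ) Finset.univ (i := j) (by omega)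
    rw [hget] at this
    simp only [hlen] at this
    rw [prop, sub_le_iff_le_add, div_le_iff₀ hn]
    linarith
  have hspec := boundedProp_spec hch n (List.ofFn τ) Finset.univ hlen
    (List.nodup_ofFn.2 τ.injective) i (by omega) (fun j hj => by
      have hjn : j < n := by omega
      rw [hget j (by omega)]
      have h1 := hcol j hjn
      -- A predecessor has at least the share of `τ i` and at most her stage number, so her column
      -- exceeds the threshold required of it.
      have h2 : I.prop (τ i) ≤ I.prop (τ ⟨j, hjn⟩) := by
        unfold prop
        have := hτ ⟨j, hjn⟩ i (by exact hj)
        gcongr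
      have h3 : (stageOf n (j + 1) : ℝ) ≤ stageOf n (i + 1) := by
        exact_mod_cast stageOf_mono n (by omega)
      linarith)
  rw [hget i (by omega)] at hspec
  have := hcol i i.2
  change _ ≤ I.value (τ i) (I.received choose τ i) at hspec
  linarith

end FairInstance

/-! ### Computing the order of arrival -/

/-- Started in memory `s`, the program halts within `T` steps in a memory that satisfies `Q`. -/
def Runs (p : Program) (s : Mem) (Q : Mem → Prop) (T : ℕ) : Prop :=
  ∃ s' t, Exec p s s' t ∧ t ≤ T ∧ Q s'

/-! ### Rules for correctness and running time of programs -/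

theorem Runs.instr {c : Instr} {s : Mem} {Q : Mem → Prop} (h : Q (c.apply s)) :
    Runs (.instr c) s Q 1 :=
  ⟨_, _, .instr c s, le_rfl, h⟩

theorem Runs.seq {p q : Program} {s : Mem} {Q R : Mem → Prop} {T T' : ℕ} (hp : Runs p s Q T)
    (hq : ∀ s', Q s' → Runs q s' R T') : Runs (.seq p q) s R (T + T') := by
  obtain ⟨s', t, he, ht, hs⟩ := hp
  obtain ⟨s'', t', he', ht', hs'⟩ := hq s' hs
  exact ⟨s'', _, .seq he he', by omega, hs'⟩

theorem Runs.instr_seq {c : Instr} {q : Program} {s : Mem} {R : Mem → Prop} {T : ℕ}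
    (hq : Runs q (c.apply s) R T) : Runs (.seq (.instr c) q) s R (1 + T) :=
  Runs.seq (Runs.instr (Q := fun s' => s' = c.apply s) rfl) (by rintro _ rfl; exact hq)

theorem Runs.cond {b : RegTest} {p q : Program} {s : Mem} {Q : Mem → Prop} {T : ℕ}
    (hp : b.Holds s → Runs p s Q T) (hq : ¬b.Holds s → Runs q s Q T) :
    Runs (.cond b p q) s Q (T + 1) := by
  by_cases hb : b.Holds s
  · obtain ⟨s', t, he, ht, hs⟩ := hp hb
    exact ⟨s', _, .cond_true hb he, by omega, hs⟩
  · obtain ⟨s', t, he, ht, hs⟩ := hq hb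
    exact ⟨s', _, .cond_false hb he, by omega, hs⟩

theorem Runs.mono {p : Program} {s : Mem} {Q R : Mem → Prop} {T T' : ℕ} (h : Runs p s Q T)
    (hQ : ∀ s', Q s' → R s') (hT : T ≤ T') : Runs p s R T' := by
  obtain ⟨s', t, he, ht, hs⟩ := h
  exact ⟨s', t, he, by omega, hQ _ hs⟩

/-- A loop with invariant `Inv k` before round `k` that ends after `K` rounds. -/
theorem Runs.loop {b : RegTest} {p : Program} {K T : ℕ} (Inv : ℕ → Mem → Prop)
    (hend : ∀ s, Inv K s → ¬b.Holds s) (hb : ∀ k < K, ∀ s, Inv k s → b.Holds s)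
    (hstep : ∀ k < K, ∀ s, Inv k s → Runs p s (Inv (k + 1)) T) :
    ∀ j k s, k + j = K → Inv k s → Runs (.loop b p) s (Inv K) (j * (T + 1) + 1) := by
  intro j
  induction j with
  | zero =>
    intro k s hk hs
    obtain rfl : k = K := by omega
    exact ⟨s, 1, .loop_false (hend s hs), by omega, hs⟩
  | succ j ih =>
    intro k s hk hs
    obtain ⟨s', t, he, ht, hs'⟩ := hstep k (by omega) s hs
    obtain ⟨s'', t', he', ht', hs''⟩ := ih (k + 1) s' (by omega) hs'
    refine ⟨s'', _, .loop_true (hb k (by omega) s hs) he he', ?_, hs''⟩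
    rw [Nat.succ_mul]
    omega

/-- Adds the next entry of the matrix to the real register `0`. -/
def rowSumBody : Program :=
  .seq (.instr (.rload 1 6)) (.seq (.instr (.radd 0 0 1)) (.seq (.instr (.nadd 6 6 4))
    (.instr (.nadd 3 3 4))))

/-- Replaces the first `n` cells of the real memory by the row sums. -/
def rowSumsBody : Program :=
  .seq (.instr (.rzero 0)) (.seq (.instr (.nconst 3 1)) (.seq (.loop (.nle 3 1) rowSumBody)
    (.seq (.instr (.nsub 5 2 4)) (.seq (.instr (.rstore 5 0)) (.instr (.nadd 2 2 4))))))

/-- Increases the counter if the row sum with number `nreg 3 - 1` precedes the one with number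
`nreg 2 - 1` in decreasing order. -/
def rankBody : Program :=
  .seq (.instr (.nsub 6 3 4)) (.seq (.instr (.rload 1 6)) (.seq
    (.cond (.rle 1 0)
      (.cond (.rle 0 1)
        -- Register `8` is never read; writing to it serves as an empty instruction.
        (.cond (.nle 2 3) (.instr (.nconst 8 0)) (.instr (.nadd 7 7 4)))
        (.instr (.nconst 8 0)))
      (.instr (.nadd 7 7 4)))
    (.instr (.nadd 3 3 4))))

/-- Writes the number of each row to the cell of its rank. -/
def ranksBody : Program :=
  .seq (.instr (.nsub 5 2 4)) (.seq (.instr (.rload 0 5)) (.seq (.instr (.nconst 7 0))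
    (.seq (.instr (.nconst 3 1)) (.seq (.loop (.nle 3 0) rankBody)
      (.seq (.instr (.nstore 7 5)) (.instr (.nadd 2 2 4)))))))

/-- Lists the rows of the matrix in the order of decreasing sums. -/
def orderProgram : Program :=
  -- Register `4` holds the constant `1`. The loop counters start at `1`, since the only test is
  -- `≤`, so the current index is the counter minus `1`.
  .seq (.instr (.nconst 4 1)) (.seq (.instr (.nconst 2 1)) (.seq (.loop (.nle 2 0) rowSumsBody)
    (.seq (.instr (.nconst 2 1)) (.loop (.nle 2 0) ranksBody))))

/-! ### Ranks in decreasing order, ties broken by index -/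

/-- Number `b` precedes number `a` in the order of decreasing `W`. -/
def Precedes (W : ℕ → ℝ) (b a : ℕ) : Prop := W a < W b ∨ (W b = W a ∧ b < a)

open scoped Classical in
/-- The number of elements of `{0, …, k - 1}` that precede `a`. -/
noncomputable def rankBelow (W : ℕ → ℝ) (k a : ℕ) : ℕ :=
  ((Finset.range k).filter fun b => Precedes W b a).card

theorem rankBelow_zero (W : ℕ → ℝ) (a : ℕ) : rankBelow W 0 a = 0 := by simp [rankBelow]

open scoped Classical in
theorem rankBelow_succ (W : ℕ → ℝ) (k a : ℕ) :
    rankBelow W (k + 1) a = rankBelow W k a + if Precedes W k a then 1 else 0 := by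
  rw [rankBelow, rankBelow, Finset.range_add_one, Finset.filter_insert]
  split_ifs
  · rw [Finset.card_insert_of_notMem (by simp)]
  · rfl

theorem Precedes.trans {W : ℕ → ℝ} {a b c : ℕ} (h : Precedes W a b) (h' : Precedes W b c) :
    Precedes W a c := by
  rcases h with h | ⟨h, h1⟩ <;> rcases h' with h' | ⟨h', h2⟩
  · exact Or.inl (h'.trans h)
  · exact Or.inl (h'.symm.trans_lt h)
  · exact Or.inl (h'.trans_eq h.symm)
  · exact Or.inr ⟨h.trans h', h1.trans h2⟩

theorem not_precedes_self (W : ℕ → ℝ) (a : ℕ) : ¬Precedes W a a := by simp [Precedes]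

theorem Precedes.rankBelow_lt {W : ℕ → ℝ} {n a b : ℕ} (hb : b < n) (h : Precedes W b a) :
    rankBelow W n b < rankBelow W n a := by
  classical
  refine Finset.card_lt_card ⟨fun c hc => ?_, fun hsub => ?_⟩
  · rw [Finset.mem_filter] at hc ⊢
    exact ⟨hc.1, hc.2.trans h⟩
  · have := hsub (Finset.mem_filter.2 ⟨Finset.mem_range.2 hb, h⟩)
    exact not_precedes_self W b (Finset.mem_filter.1 this).2

theorem rankBelow_lt {W : ℕ → ℝ} {n a : ℕ} (ha : a < n) : rankBelow W n a < n := by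
  classical
  conv_rhs => rw [← Finset.card_range n]
  refine Finset.card_lt_card ⟨Finset.filter_subset _ _, fun hsub => ?_⟩
  exact not_precedes_self W a (Finset.mem_filter.1 (hsub (Finset.mem_range.2 ha))).2

theorem rankBelow_injOn {W : ℕ → ℝ} {n a b : ℕ} (ha : a < n) (hb : b < n)
    (h : rankBelow W n a = rankBelow W n b) : a = b := by
  by_contra hne
  have : Precedes W a b ∨ Precedes W b a := by
    rcases lt_trichotomy (W a) (W b) with h1 | h1 | h1
    · exact Or.inr (Or.inl h1)
    · rcases Nat.lt_or_gt_of_ne hne with h2 | h2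
      · exact Or.inl (Or.inr ⟨h1, h2⟩)
      · exact Or.inr (Or.inr ⟨h1.symm, h2⟩)
    · exact Or.inl (Or.inl h1)
  rcases this with h1 | h1
  · exact (h1.rankBelow_lt ha).ne h
  · exact (h1.rankBelow_lt hb).ne' h

/-! ### Correctness and running time of the sorting program -/

theorem runs_rowSum {n m a : ℕ} {w : ℕ → ℝ} {W : ℕ → ℝ} {s : Mem}
    (hs : s.nreg 0 = n ∧ s.nreg 1 = m ∧ s.nreg 2 = a + 1 ∧ s.nreg 3 = 1 ∧ s.nreg 4 = 1 ∧
      s.nreg 6 = a * m ∧ s.rreg 0 = 0 ∧ (∀ k < a, s.rmem k = W k) ∧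
      ∀ k, a ≤ k → a * m ≤ k → s.rmem k = w k) :
    Runs (.loop (.nle 3 1) rowSumBody) s (fun s => s.nreg 0 = n ∧ s.nreg 1 = m ∧
      s.nreg 2 = a + 1 ∧ s.nreg 3 = m + 1 ∧ s.nreg 4 = 1 ∧
      s.nreg 6 = a * m + m ∧ s.rreg 0 = ∑ j ∈ Finset.range m, w (a * m + j) ∧
      (∀ k < a, s.rmem k = W k) ∧ ∀ k, a ≤ k → a * m ≤ k → s.rmem k = w k) (m * 5 + 1) := by
  refine Runs.loop (K := m) (T := 4) (fun k s => s.nreg 0 = n ∧ s.nreg 1 = m ∧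
      s.nreg 2 = a + 1 ∧ s.nreg 3 = k + 1 ∧ s.nreg 4 = 1 ∧
      s.nreg 6 = a * m + k ∧ s.rreg 0 = ∑ j ∈ Finset.range k, w (a * m + j) ∧
      (∀ k < a, s.rmem k = W k) ∧ ∀ k, a ≤ k → a * m ≤ k → s.rmem k = w k)
    ?_ ?_ ?_ m 0 s (by omega) (by simpa using hs)
  · rintro s ⟨-, h1, -, h3, -⟩
    simp [RegTest.Holds, h1, h3]
  · rintro k hk s ⟨-, h1, -, h3, -⟩
    simp [RegTest.Holds, h1, h3]; omega
  · rintro k hk s ⟨h0, h1, h2, h3, h4, h6, hr, hW, hw⟩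
    have ha : a ≤ a * m := Nat.le_mul_of_pos_right a (by omega)
    have hload := hw (a * m + k) (by omega) (by omega)
    refine Runs.instr_seq (Runs.instr_seq (Runs.instr_seq (Runs.instr ?_)))
    simp [Instr.apply, h0, h1, h2, h3, h4, h6, hr, hload, Finset.sum_range_succ, add_assoc]
    exact ⟨hW, hw⟩

/-- The sums may overwrite the matrix: for `m > 0`, cell `a` lies before the start of row `a + 1`,
so its entry has been read by then. For `m = 0` no entry is ever read, and the condition `a ≤ k` in
the invariant exempts the cells already overwritten. -/
theorem runs_rowSums {n m : ℕ} {w : ℕ → ℝ} {s : Mem}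
    (hs : s.nreg 0 = n ∧ s.nreg 1 = m ∧ s.nreg 2 = 1 ∧ s.nreg 4 = 1 ∧ s.nreg 6 = 0 ∧
      ∀ k, s.rmem k = w k) :
    Runs (.loop (.nle 2 0) rowSumsBody) s (fun s => s.nreg 0 = n ∧ s.nreg 4 = 1 ∧
      ∀ k < n, s.rmem k = ∑ j ∈ Finset.range m, w (k * m + j)) (n * (m * 5 + 7) + 1) := by
  refine (Runs.loop (K := n) (T := m * 5 + 6) (fun a s => s.nreg 0 = n ∧ s.nreg 1 = m ∧
      s.nreg 2 = a + 1 ∧ s.nreg 4 = 1 ∧ s.nreg 6 = a * m ∧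
      (∀ k < a, s.rmem k = ∑ j ∈ Finset.range m, w (k * m + j)) ∧
      ∀ k, a ≤ k → a * m ≤ k → s.rmem k = w k)
    ?_ ?_ ?_ n 0 s (by omega) (by simpa using hs)).mono
    (fun s h => ⟨h.1, h.2.2.2.1, h.2.2.2.2.2.1⟩) le_rfl
  · rintro s ⟨h0, -, h2, -⟩
    simp [RegTest.Holds, h0, h2]
  · rintro k hk s ⟨h0, -, h2, -⟩
    simp [RegTest.Holds, h0, h2]; omega
  · rintro a ha s ⟨h0, h1, h2, h4, h6, hW, hw⟩
    refine (Runs.instr_seq (Runs.instr_seq (Runs.seq (runs_rowSum (n := n) (m := m) (a := a) (w := w)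
      (W := fun k => ∑ j ∈ Finset.range m, w (k * m + j)) ?_) (T' := 1 + (1 + 1)) fun s' hs' =>
      Runs.instr_seq (Runs.instr_seq (Runs.instr ?_))))).mono (fun _ h => h) ?_
    · simp [Instr.apply, h0, h1, h2, h4, h6]
      exact ⟨hW, hw⟩
    · obtain ⟨h0, h1, h2, h3, h4, h6, hr, hW, hw⟩ := hs'
      simp [Instr.apply, h0, h1, h2, h4, h6, hr, Nat.succ_mul]
      refine ⟨fun k hk => ?_, fun k hk hk' => ?_⟩
      · rw [Function.update_apply]
        split_ifs with h
        · rw [h]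
        · exact hW k (by omega)
      · rw [Function.update_of_ne (by omega)]
        exact hw k (by omega) (by omega)
    · omega

theorem runs_rank {n a : ℕ} {W : ℕ → ℝ} {s : Mem} {f : ℕ → ℕ}
    (hs : s.nreg 0 = n ∧ s.nreg 2 = a + 1 ∧ s.nreg 3 = 1 ∧ s.nreg 4 = 1 ∧ s.nreg 5 = a ∧
      s.nreg 7 = 0 ∧ s.rreg 0 = W a ∧ (∀ k < n, s.rmem k = W k) ∧ s.nmem = f) :
    Runs (.loop (.nle 3 0) rankBody) s (fun s => s.nreg 0 = n ∧ s.nreg 2 = a + 1 ∧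
      s.nreg 3 = n + 1 ∧ s.nreg 4 = 1 ∧ s.nreg 5 = a ∧ s.nreg 7 = rankBelow W n a ∧
      s.rreg 0 = W a ∧ (∀ k < n, s.rmem k = W k) ∧ s.nmem = f) (n * 8 + 1) := by
  refine Runs.loop (K := n) (T := 7) (fun k s => s.nreg 0 = n ∧ s.nreg 2 = a + 1 ∧
      s.nreg 3 = k + 1 ∧ s.nreg 4 = 1 ∧ s.nreg 5 = a ∧ s.nreg 7 = rankBelow W k a ∧
      s.rreg 0 = W a ∧ (∀ k < n, s.rmem k = W k) ∧ s.nmem = f)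
    ?_ ?_ ?_ n 0 s (by omega) (by simpa [rankBelow_zero] using hs)
  · rintro s ⟨h0, -, h3, -⟩
    simp [RegTest.Holds, h0, h3]
  · rintro k hk s ⟨h0, -, h3, -⟩
    simp [RegTest.Holds, h0, h3]; omega
  · rintro k hk s ⟨h0, h2, h3, h4, h5, h7, hr, hW, hf⟩
    have hload := hW k hk
    refine Runs.instr_seq (Runs.instr_seq (Runs.seq (T := 4) (T' := 1) (Q := fun s =>
      s.nreg 0 = n ∧ s.nreg 2 = a + 1 ∧
      s.nreg 3 = k + 1 ∧ s.nreg 4 = 1 ∧ s.nreg 5 = a ∧ s.nreg 7 = rankBelow W (k + 1) a ∧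
      s.rreg 0 = W a ∧ (∀ k < n, s.rmem k = W k) ∧ s.nmem = f) ?_ ?_))
    -- The longest branch makes three tests and one instruction, hence the bound `4`; the shorter
    -- branches are padded.
    · refine Runs.cond (fun hc => Runs.cond (fun hc' => Runs.cond (fun hc'' => ?_) fun hc'' => ?_)
        fun hc' => ?_) fun hc => ?_
      all_goals
        refine (Runs.instr ?_).mono (fun _ h => h) (by omega)
        simp [RegTest.Holds, Instr.apply, h2, h3, h4, hr, hload] at *
        refine ⟨h0, h5, ?_, hW, hf⟩
        rw [rankBelow_succ]
        simp [Precedes, h7]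
        grind
    · rintro s ⟨h0, h2, h3, h4, h5, h7, hr, hW, hf⟩
      refine Runs.instr ?_
      simp [Instr.apply, h0, h2, h3, h4, h5, h7, hr, hf]
      exact hW

theorem runs_ranks {n : ℕ} {W : ℕ → ℝ} {s : Mem}
    (hs : s.nreg 0 = n ∧ s.nreg 2 = 1 ∧ s.nreg 4 = 1 ∧ ∀ k < n, s.rmem k = W k) :
    Runs (.loop (.nle 2 0) ranksBody) s (fun s => ∀ a < n, s.nmem (rankBelow W n a) = a)
      (n * (n * 8 + 8) + 1) := by
  refine (Runs.loop (K := n) (T := n * 8 + 7) (fun a s => s.nreg 0 = n ∧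
      s.nreg 2 = a + 1 ∧ s.nreg 4 = 1 ∧ (∀ k < n, s.rmem k = W k) ∧
      ∀ k < a, s.nmem (rankBelow W n k) = k)
    ?_ ?_ ?_ n 0 s (by omega) (by simpa using hs)).mono (fun s h => h.2.2.2.2) le_rfl
  · rintro s ⟨h0, h2, -⟩
    simp [RegTest.Holds, h0, h2]
  · rintro k hk s ⟨h0, h2, -⟩
    simp [RegTest.Holds, h0, h2]; omega
  · rintro a ha s ⟨h0, h2, h4, hW, hf⟩
    refine (Runs.instr_seq (Runs.instr_seq (Runs.instr_seq (Runs.instr_seq (Runs.seq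
      (runs_rank (n := n) (a := a) (W := W) (f := s.nmem) ?_) (T' := 1 + 1) fun s' hs' =>
      Runs.instr_seq (Runs.instr ?_)))))).mono (fun _ h => h) ?_
    · simp [Instr.apply, h0, h2, h4, hW a ha]
      exact hW
    · obtain ⟨h0, h2, -, h4, h5, h7, -, hW, hf'⟩ := hs'
      simp [Instr.apply, h0, h2, h4, h5, h7, hf']
      refine ⟨hW, fun k hk => ?_⟩
      rw [Function.update_apply]
      split_ifs with h
      -- Ranks are distinct, so no earlier entry is overwritten.
      · exact (rankBelow_injOn (by omega) ha h).symm
      · exact hf k (lt_of_le_of_ne (by omega) fun hka => h (by rw [hka]))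
    · omega

theorem runs_orderProgram {n m : ℕ} (I : FairInstance n m) {W : ℕ → ℝ}
    (hW : ∀ a : Fin n, W a = I.value a Finset.univ) :
    Runs orderProgram I.input (fun s => ∀ a < n, s.nmem (rankBelow W n a) = a)
      (8 * (n + m + 1) ^ 2) := by
  have hrow : ∀ k < n, ∑ j ∈ Finset.range m, I.input.rmem (k * m + j) = W k := by
    intro k hk
    rw [hW ⟨k, hk⟩, FairInstance.value, ← Fin.sum_univ_eq_sum_range]
    refine Finset.sum_congr rfl fun j _ => ?_
    have hlt : k * m + j < n * m := by
      calc k * m + j < k * m + m := by omega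
        _ = (k + 1) * m := (Nat.succ_mul k m).symm
        _ ≤ n * m := Nat.mul_le_mul_right m hk
    simp only [FairInstance.input, dif_pos hlt]
    congr 1
    · ext
      simp only [Fin.coe_divNat]
      rw [mul_comm, Nat.mul_add_div (by omega), Nat.div_eq_of_lt j.2, add_zero]
    · ext
      simp only [Fin.coe_modNat]
      exact Nat.mul_add_mod_of_lt j.2
  refine (Runs.instr_seq (Runs.instr_seq (Runs.seq (runs_rowSums (n := n) (m := m)
    (w := I.input.rmem) ?_) fun s hs => Runs.instr_seq (runs_ranks (n := n) (W := W) ?_)))).mono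
    (fun _ h => h) ?_
  · simp [Instr.apply, FairInstance.input]
  · obtain ⟨h0, h4, hs⟩ := hs
    simp [Instr.apply, h0, h4]
    intro k hk
    rw [hs k hk, hrow k hk]
  -- The exact bound is `8 * n ^ 2 + 5 * n * m + 15 * n + 5`.
  · nlinarith [Nat.zero_le (n * m), Nat.zero_le (m * m), Nat.zero_le (n * n)]

/-- The agents in the order of decreasing total value. -/
theorem exists_perm_rankBelow (n : ℕ) (W : ℕ → ℝ) :
    ∃ τ : Equiv.Perm (Fin n), ∀ i, rankBelow W n (τ i) = i := by
  let f : Fin n → Fin n := fun a => ⟨rankBelow W n a, rankBelow_lt a.2⟩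
  have hf : Function.Injective f := fun a b h =>
    Fin.ext (rankBelow_injOn a.2 b.2 (congrArg Fin.val h))
  refine ⟨(Equiv.ofBijective f (Finite.injective_iff_bijective.1 hf)).symm, fun i => ?_⟩
  exact congrArg Fin.val ((Equiv.ofBijective f
    (Finite.injective_iff_bijective.1 hf)).apply_symm_apply i)

theorem mainTheorem10 :
    ∃ (prog : Program) (T : Polynomial ℕ), ∀ (n m : ℕ) (I : FairInstance n m),
      ∃ τ : Equiv.Perm (Fin n),
        prog.ComputesOrder I τ (T.eval (n + m)) ∧
        ∀ choose : ChoiceRule n m, I.Rational choose →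
          ∀ i : Fin n,
            I.prop (τ i) - 2 * (stageOf n ((i : ℕ) + 1) : ℝ) - 2
              ≤ I.value (τ i) (I.received choose τ i) := by
  refine ⟨orderProgram, 8 * (Polynomial.X + 1) ^ 2, fun n m I => ?_⟩
  let W : ℕ → ℝ := fun k => if h : k < n then I.value ⟨k, h⟩ Finset.univ else 0
  have hW (a : Fin n) : W a = I.value a Finset.univ := by simp [W]
  obtain ⟨τ, hτ⟩ := exists_perm_rankBelow n W
  refine ⟨τ, ?_, fun choose hch i => FairInstance.prop_sub_le_value_received ?_ hch i⟩
  · obtain ⟨s, t, he, ht, hs⟩ := runs_orderProgram I hW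
    refine ⟨s, t, he, by simpa using ht, fun i => ?_⟩
    -- The order is the inverse of the rank function: cell `i` contains the agent of rank `i`.
    rw [← hs (τ i) (τ i).2, hτ]
  · intro i j hij
    by_contra! hlt
    rw [← hW, ← hW] at hlt
    have := Precedes.rankBelow_lt (n := n) (τ j).2 (Or.inl hlt : Precedes W (τ j) (τ i))
    rw [hτ, hτ] at this
    exact absurd hij (by simpa using this)
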